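/- Let $(X,\mathcal B,m)$ be a probability space and let $\tau$ be an invertible measure-preserving transformation of $X$. For a probability measure $\mu$ on $\mathbb Z$ put $E(\mu)=\sum_{k}k\,\mu(k)$, $m_2(\mu)=\sum_k |k|^2\mu(k)\in[0,\infty]$, $\hat\mu(t)=\sum_k \mu(k)e^{2\pi i k t}$, and $\mu f(x)=\sum_{k\in\mathbb Z}\mu(k)f(\tau^kx)$; call $\mu$ strictly aperiodic if its support is not contained in a coset of a proper subgroup of $\mathbb Z$. Let $(\nu_n)_{n\ge1}$ be a sequence of strictly aperiodic probability measures on $\mathbb Z$ such that 1. $E(\nu_n)=0$ for all $n$; 2. $\sum_{i=1}^n m_2(\nu_i)=O(n)$; 3. there exist a constant $C>0$ and an integer $N_0$ such that $|\hat\nu_n(t)|\le e^{-Ct^2}$ for all $n>N_0$ and all $t\in[-1/2,1/2)$. Let $\mu_n=\nu_1*\cdots*\nu_n$. Then for every $f\in L^1(X)$ (real-valued), for $m$-almost every $x\in X$ the series defining $\mu_nf(x)$ converges absolutely for every $n$, and the sequence $(\mu_nf(x))_{n\ge1}$ converges to a finite limit. -/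

import Mathlib

open Filter Topology MeasureTheory
open scoped NNReal ENNReal

noncomputable section

namespace ConvMeasures

/-- A probability measure on `ℤ` is strictly aperiodic if its support is not contained in a coset
`a + H` of a proper subgroup `H` of `ℤ`. -/
def StrictlyAperiodic (μ : Measure ℤ) : Prop :=
  ∀ H : AddSubgroup ℤ, H ≠ ⊤ → ∀ a : ℤ, ¬ ∀ k ∈ μ.support, -a + k ∈ H

/-- The `p`-th moment `m_p(μ) = ∑_k |k|^p μ(k)`, a number in `[0, ∞]`. -/
def moment (p : ℝ) (μ : Measure ℤ) : ℝ≥0∞ :=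
  ∑' k : ℤ, ENNReal.ofReal (|(k : ℝ)| ^ p) * μ {k}

/-- The expectation `E(μ) = ∑_k k μ(k)`. The series converges absolutely as soon as
`μ` is a probability measure with `moment 2 μ < ∞`. -/
def expectation (μ : Measure ℤ) : ℝ :=
  ∑' k : ℤ, (k : ℝ) * μ.real {k}

/-- The Fourier transform `μ̂(t) = ∑_k μ(k) e^{2πikt}`. -/
def fourierTransform (μ : Measure ℤ) (t : ℝ) : ℂ :=
  ∑' k : ℤ, (μ.real {k} : ℂ) * Complex.exp (2 * Real.pi * Complex.I * k * t)

/-- The convolution `ν 0 ∗ ⋯ ∗ ν (n - 1)` of the first `n` members of a sequence of measures. -/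
def convProd (ν : ℕ → Measure ℤ) : ℕ → Measure ℤ
  | 0 => Measure.dirac 0
  | n + 1 => Measure.conv (convProd ν n) (ν n)

/-- The `k`-th term `μ(k) f(τ^k x)` of the weighted average, `k ∈ ℤ`. -/
def averageTerm {X : Type*} [MeasurableSpace X] (μ : Measure ℤ) (τ : X ≃ᵐ X) (f : X → ℝ)
    (x : X) (k : ℤ) : ℝ :=
  μ.real {k} * f (((τ.toEquiv : Equiv.Perm X) ^ k) x)

/-- The weighted average `μ f(x) = ∑_k μ(k) f(τ^k x)`. -/
def average {X : Type*} [MeasurableSpace X] (μ : Measure ℤ) (τ : X ≃ᵐ X) (f : X → ℝ)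
    (x : X) : ℝ :=
  ∑' k : ℤ, averageTerm μ τ f x k

end ConvMeasures

end

/-!
The kernels `μ_n = ν 0 ∗ ⋯ ∗ ν (n - 1)` spread like a Gaussian of variance of order `n`, and two
consequences of this give almost everywhere convergence: `μ_n` is dominated by ordinary ergodic
averages, and it becomes invariant under translation.

Let `F_p(t) = ∑_k k^p μ_n(k) e^{2πikt}` for `p = 0, 1, 2`. These obey the product rules of a
function and its first two derivatives under convolution. Since the means vanish, `F_1` of a single
factor is at most `2π|t|` times its variance, and expanding the product
(`norm_momentTransform_convProd_le`) gives `|F_0| = O(e^{-Cnt²})` and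
`|F_2| = O((n + n²t²) e^{-Cnt²})` on the circle; the finitely many factors without a Gaussian bound
only cost a constant. Fourier inversion turns this into `μ_n(k) = O(n^{-1/2})`,
`k² μ_n(k) = O(n^{1/2})` and `μ_n(k + 1) - μ_n(k) = O(1/n)` (`exists_kernel_bounds`).

The first two bounds say that `μ_n(k) = O(s / (s + |k|)²)` with `s = √n`, a decreasing function of
`|k|` of bounded mass. By Abel summation `|μ_n f|` is bounded by a constant times the supremum of
the one-sided ergodic averages of `|f|` under `τ` and `τ⁻¹`, so Hopf's maximal ergodic theorem
yields a weak type `(1, 1)` inequality (`exists_exceptional_set`).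

All three bounds together show that the total variation of `μ_n - δ₁ ∗ μ_n` tends to zero
(`tendsto_tsum_abs_sub_of_bounds`), so that `μ_n (g - g ∘ τ) → 0` uniformly for bounded `g`, while
`μ_n h = h` for invariant `h`. By the mean ergodic theorem the sums `h + (g - g ∘ τ)` are dense in
`L¹` (`exists_invariant_add_coboundary`), and the maximal inequality extends the convergence to all
of `L¹`.
-/

noncomputable section

namespace ConvMeasures


/-! ### Fourier transforms of moments -/

/-- The character `k ↦ e^{2πikt}` of `ℤ`. -/
def phase (k : ℤ) (t : ℝ) : ℂ := Complex.exp (2 * Real.pi * Complex.I * k * t)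

/-- The Fourier transform `∑_k k^p μ(k) e^{2πikt}` of the `p`-th moment sequence of `μ`. Up to the
factor `(2πi)^p` this is the `p`-th derivative of the Fourier transform of `μ`. -/
def momentTransform (p : ℕ) (μ : Measure ℤ) (t : ℝ) : ℂ := ∫ k, (k : ℂ) ^ p * phase k t ∂μ

lemma phase_eq (k : ℤ) (t : ℝ) :
    phase k t = Complex.exp (((2 * Real.pi * k * t : ℝ) : ℂ) * Complex.I) := by
  unfold phase
  congr 1
  push_cast
  ring

lemma norm_phase (k : ℤ) (t : ℝ) : ‖phase k t‖ = 1 := by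
  rw [phase_eq, Complex.norm_exp_ofReal_mul_I]

lemma phase_add (j k : ℤ) (t : ℝ) : phase (j + k) t = phase j t * phase k t := by
  unfold phase
  rw [← Complex.exp_add]
  congr 1
  push_cast
  ring

lemma norm_phase_sub_one_le (k : ℤ) (t : ℝ) :
    ‖phase k t - 1‖ ≤ 2 * Real.pi * |(k : ℝ)| * |t| := by
  rw [phase_eq, mul_comm]
  refine Real.norm_exp_I_mul_ofReal_sub_one_le.trans (le_of_eq ?_)
  rw [Real.norm_eq_abs, abs_mul, abs_mul, abs_mul, abs_of_pos Real.pi_pos, abs_two]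

lemma continuous_phase (k : ℤ) : Continuous (phase k) := by
  unfold phase
  fun_prop

/-- Orthogonality of the characters. -/
lemma integral_phase (k : ℤ) :
    ∫ t in (-(1 / 2) : ℝ)..(1 / 2), phase k t = if k = 0 then 1 else 0 := by
  split_ifs with h
  · subst h
    simp [phase]
    norm_num
  · have hc : 2 * Real.pi * Complex.I * k ≠ 0 := by
      simp [h, Real.pi_ne_zero]
    unfold phase
    rw [integral_exp_mul_complex hc]
    have : Complex.exp (2 * Real.pi * Complex.I * k * ((1 / 2 : ℝ) : ℂ)) =
        Complex.exp (2 * Real.pi * Complex.I * k * ((-(1 / 2) : ℝ) : ℂ)) := by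
      rw [Complex.exp_eq_exp_iff_exists_int]
      refine ⟨k, ?_⟩
      push_cast
      ring
    rw [this, sub_self, zero_div]

lemma integrable_abs_pow {μ : Measure ℤ} [IsProbabilityMeasure μ]
    (h : Integrable (fun k : ℤ => (k : ℝ) ^ 2) μ) {p : ℕ} (hp : p ≤ 2) :
    Integrable (fun k : ℤ => |(k : ℝ)| ^ p) μ := by
  refine ((integrable_const (1 : ℝ)).add h).mono' (by fun_prop) (ae_of_all _ fun k => ?_)
  rw [Real.norm_eq_abs, abs_pow, abs_abs]
  simp only [Pi.add_apply]
  rw [← sq_abs]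
  have := abs_nonneg (k : ℝ)
  interval_cases p <;> nlinarith [sq_nonneg (|(k : ℝ)| - 1)]

lemma norm_pow_mul_phase (p : ℕ) (k : ℤ) (t : ℝ) :
    ‖(k : ℂ) ^ p * phase k t‖ = |(k : ℝ)| ^ p := by
  rw [norm_mul, norm_phase, mul_one, norm_pow, Complex.norm_intCast]

lemma integrable_pow_mul_phase {μ : Measure ℤ} [IsProbabilityMeasure μ]
    (h : Integrable (fun k : ℤ => (k : ℝ) ^ 2) μ) {p : ℕ} (hp : p ≤ 2) (t : ℝ) :
    Integrable (fun k : ℤ => (k : ℂ) ^ p * phase k t) μ :=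
  (integrable_abs_pow h hp).mono' (by fun_prop)
    (ae_of_all _ fun k => (norm_pow_mul_phase p k t).le)

lemma momentTransform_zero (μ : Measure ℤ) [IsProbabilityMeasure μ]
    (h : Integrable (fun k : ℤ => (k : ℝ) ^ 2) μ) (t : ℝ) :
    momentTransform 0 μ t = fourierTransform μ t := by
  unfold momentTransform fourierTransform
  rw [integral_countable (integrable_pow_mul_phase h (by norm_num) t)]
  simp [phase]

lemma norm_momentTransform_zero_le (μ : Measure ℤ) [IsProbabilityMeasure μ] (t : ℝ) :
    ‖momentTransform 0 μ t‖ ≤ 1 := by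
  refine (norm_integral_le_integral_norm _).trans ?_
  simp [norm_phase]

/-- Because the mean vanishes, the first moment transform is `O(|t|)`. -/
lemma norm_momentTransform_one_le {μ : Measure ℤ} [IsProbabilityMeasure μ]
    (h : Integrable (fun k : ℤ => (k : ℝ) ^ 2) μ) (h0 : expectation μ = 0) (t : ℝ) :
    ‖momentTransform 1 μ t‖ ≤ 2 * Real.pi * |t| * ∫ k : ℤ, (k : ℝ) ^ 2 ∂μ := by
  have hI : Integrable (fun k : ℤ => (k : ℝ)) μ := by
    refine (integrable_abs_pow h (p := 1) (by norm_num)).mono' (by fun_prop) (ae_of_all _ ?_)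
    simp
  have hE : ∫ k : ℤ, (k : ℂ) ∂μ = 0 := by
    have h1 : ∫ k : ℤ, (k : ℝ) ∂μ = 0 := by
      rw [integral_countable hI, ← h0]
      simp [expectation, mul_comm]
    have h2 := integral_complex_ofReal (μ := μ) (f := fun k : ℤ => (k : ℝ))
    rw [h1] at h2
    simpa using h2
  have hIc : Integrable (fun k : ℤ => (k : ℂ)) μ := by
    simpa using hI.ofReal (𝕜 := ℂ)
  have key : momentTransform 1 μ t = ∫ k : ℤ, (k : ℂ) * (phase k t - 1) ∂μ := by
    have := integral_sub (integrable_pow_mul_phase h (p := 1) (by norm_num) t) hIc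
    rw [hE, sub_zero] at this
    rw [momentTransform, ← this]
    congr 1
    ext k
    ring
  rw [key, ← integral_const_mul]
  refine norm_integral_le_of_norm_le (h.const_mul _) (ae_of_all _ fun k => ?_)
  rw [norm_mul, Complex.norm_intCast, ← sq_abs (k : ℝ)]
  calc |(k : ℝ)| * ‖phase k t - 1‖ ≤ |(k : ℝ)| * (2 * Real.pi * |(k : ℝ)| * |t|) := by
        gcongr
        exact norm_phase_sub_one_le k t
    _ = _ := by ring

lemma norm_momentTransform_two_le (μ : Measure ℤ) (t : ℝ) :
    ‖momentTransform 2 μ t‖ ≤ ∫ k : ℤ, (k : ℝ) ^ 2 ∂μ := by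
  refine (norm_integral_le_integral_norm _).trans (le_of_eq ?_)
  simp only [norm_pow_mul_phase, sq_abs]

section conv

variable {μ ν : Measure ℤ}

lemma momentTransform_conv_eq (p : ℕ) (t : ℝ) :
    momentTransform p (μ.conv ν) t =
      ∫ z : ℤ × ℤ, ((z.1 : ℂ) + z.2) ^ p * (phase z.1 t * phase z.2 t) ∂(μ.prod ν) := by
  unfold momentTransform Measure.conv
  rw [integral_map (by fun_prop) (by fun_prop)]
  simp only [phase_add, Int.cast_add]

lemma momentTransform_conv_zero [SFinite μ] [SFinite ν] (t : ℝ) :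
    momentTransform 0 (μ.conv ν) t = momentTransform 0 μ t * momentTransform 0 ν t := by
  rw [momentTransform_conv_eq]
  simp only [momentTransform, pow_zero, one_mul]
  exact integral_prod_mul (fun k => phase k t) (fun k => phase k t)

variable [IsProbabilityMeasure μ] [IsProbabilityMeasure ν]

lemma integrable_sq_conv (hμ : Integrable (fun k : ℤ => (k : ℝ) ^ 2) μ)
    (hν : Integrable (fun k : ℤ => (k : ℝ) ^ 2) ν) :
    Integrable (fun k : ℤ => (k : ℝ) ^ 2) (μ.conv ν) := by
  unfold Measure.conv
  rw [integrable_map_measure (by fun_prop) (by fun_prop)]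
  refine (((hμ.comp_fst ν).const_mul 2).add ((hν.comp_snd μ).const_mul 2)).mono' (by fun_prop)
    (ae_of_all _ fun z => ?_)
  simp only [Function.comp_apply, Pi.add_apply, Real.norm_eq_abs, Int.cast_add]
  rw [abs_of_nonneg (sq_nonneg _)]
  nlinarith [sq_nonneg ((z.1 : ℝ) - z.2)]

/-- The product rule for the first derivative. -/
lemma momentTransform_conv_one (hμ : Integrable (fun k : ℤ => (k : ℝ) ^ 2) μ)
    (hν : Integrable (fun k : ℤ => (k : ℝ) ^ 2) ν) (t : ℝ) :
    momentTransform 1 (μ.conv ν) t =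
      momentTransform 1 μ t * momentTransform 0 ν t +
        momentTransform 0 μ t * momentTransform 1 ν t := by
  rw [momentTransform_conv_eq]
  have I := fun (p : ℕ) (hp : p ≤ 2) => integrable_pow_mul_phase hμ hp t
  have J := fun (p : ℕ) (hp : p ≤ 2) => integrable_pow_mul_phase hν hp t
  unfold momentTransform
  simp only [← integral_prod_mul]
  rw [← integral_add ((I 1 (by norm_num)).mul_prod (J 0 (by norm_num)))
    ((I 0 (by norm_num)).mul_prod (J 1 (by norm_num)))]
  congr 1
  ext z
  ring

/-- The product rule for the second derivative. -/
lemma momentTransform_conv_two (hμ : Integrable (fun k : ℤ => (k : ℝ) ^ 2) μ)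
    (hν : Integrable (fun k : ℤ => (k : ℝ) ^ 2) ν) (t : ℝ) :
    momentTransform 2 (μ.conv ν) t =
      momentTransform 2 μ t * momentTransform 0 ν t +
        2 * (momentTransform 1 μ t * momentTransform 1 ν t) +
          momentTransform 0 μ t * momentTransform 2 ν t := by
  rw [momentTransform_conv_eq]
  have I := fun (p : ℕ) (hp : p ≤ 2) => integrable_pow_mul_phase hμ hp t
  have J := fun (p : ℕ) (hp : p ≤ 2) => integrable_pow_mul_phase hν hp t
  unfold momentTransform
  simp only [← integral_prod_mul]
  have h2 := (I 2 (by norm_num)).mul_prod (J 0 (by norm_num))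
  have h1 := ((I 1 (by norm_num)).mul_prod (J 1 (by norm_num))).const_mul 2
  have h0 := (I 0 (by norm_num)).mul_prod (J 2 (by norm_num))
  rw [← integral_const_mul, ← integral_add h2 h1]
  refine Eq.trans ?_ (integral_add (h2.add h1) h0)
  congr 1
  ext z
  ring

end conv

/-- Fourier inversion for the moment sequences. -/
lemma integral_momentTransform_mul_phase {μ : Measure ℤ} [IsProbabilityMeasure μ]
    (h : Integrable (fun k : ℤ => (k : ℝ) ^ 2) μ) {p : ℕ} (hp : p ≤ 2) (k : ℤ) :
    ∫ t in (-(1 / 2) : ℝ)..(1 / 2), momentTransform p μ t * phase (-k) t =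
      (k : ℂ) ^ p * μ.real {k} := by
  have hfin : IsFiniteMeasure (volume.restrict (Set.uIoc (-(1 / 2) : ℝ) (1 / 2))) :=
    ⟨by simp [Set.uIoc]⟩
  have hm : Integrable (Function.uncurry fun (t : ℝ) (j : ℤ) => (j : ℂ) ^ p * phase (j + -k) t)
      ((volume.restrict (Set.uIoc (-(1 / 2) : ℝ) (1 / 2))).prod μ) := by
    refine ((integrable_abs_pow h hp).comp_snd _).mono' (Measurable.aestronglyMeasurable ?_)
      (ae_of_all _ fun z => ?_)
    · refine measurable_from_prod_countable_left fun j => ?_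
      exact ((continuous_phase (j + -k)).const_mul ((j : ℂ) ^ p)).measurable
    · simp only [Function.uncurry]
      rw [norm_mul, norm_phase, mul_one, norm_pow, Complex.norm_intCast]
  have h1 : ∀ t, momentTransform p μ t * phase (-k) t =
      ∫ j, (j : ℂ) ^ p * phase (j + -k) t ∂μ := by
    intro t
    rw [momentTransform, ← integral_mul_const]
    simp only [phase_add, mul_assoc]
  simp only [h1]
  rw [intervalIntegral_integral_swap hm]
  simp only [intervalIntegral.integral_const_mul, integral_phase, ← sub_eq_add_neg, sub_eq_zero]
  have : (fun j : ℤ => (j : ℂ) ^ p * if j = k then 1 else 0) =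
      Set.indicator {k} fun _ => (k : ℂ) ^ p := by
    ext j
    by_cases hj : j = k
    · simp [hj]
    · simp [hj]
  rw [this, integral_indicator_const _ (measurableSet_singleton k)]
  simp [mul_comm]

lemma integral_exp_neg_mul_sq_le {b : ℝ} (hb : 0 < b) :
    ∫ t in (-(1 / 2) : ℝ)..(1 / 2), Real.exp (-b * t ^ 2) ≤ √(Real.pi / b) := by
  rw [intervalIntegral.integral_of_le (by norm_num), ← integral_gaussian]
  exact setIntegral_le_integral (integrable_exp_neg_mul_sq hb)
    (ae_of_all _ fun t => (Real.exp_pos _).le)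

/-- A function on the circle with a Gaussian bound `E e^{-bt²}` has integral `O(E b^{-1/2})`. -/
lemma norm_integral_le_of_gaussian_bound {b E : ℝ} (hb : 0 < b) (hE : 0 ≤ E) {F : ℝ → ℂ}
    (hF : ∀ t ∈ Set.Ico (-(1 / 2) : ℝ) (1 / 2), ‖F t‖ ≤ E * Real.exp (-b * t ^ 2)) :
    ‖∫ t in (-(1 / 2) : ℝ)..(1 / 2), F t‖ ≤ E * √(Real.pi / b) := by
  calc _ ≤ ∫ t in (-(1 / 2) : ℝ)..(1 / 2), E * Real.exp (-b * t ^ 2) := by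
        refine intervalIntegral.norm_integral_le_of_norm_le (by norm_num) ?_
          (Continuous.intervalIntegrable (by fun_prop) _ _)
        have h2 : ∀ᵐ t : ℝ, t ≠ 1 / 2 := by
          rw [ae_iff]; simp
        filter_upwards [h2] with t ht ht'
        exact hF t ⟨ht'.1.le, lt_of_le_of_ne ht'.2 ht⟩
    _ ≤ _ := by
        rw [intervalIntegral.integral_const_mul]
        gcongr
        exact integral_exp_neg_mul_sq_le hb


/-! ### Decay of the kernels `ν 0 ∗ ⋯ ∗ ν (n - 1)` -/

/-- The second moment as a real number, which is the variance if the mean vanishes. The integral has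
the junk value `0` if `moment 2 μ = ∞`. -/
def variance (μ : Measure ℤ) : ℝ := ∫ k : ℤ, (k : ℝ) ^ 2 ∂μ

lemma variance_nonneg (μ : Measure ℤ) : 0 ≤ variance μ := integral_nonneg fun _ => sq_nonneg _

lemma moment_two_eq (μ : Measure ℤ) :
    moment 2 μ = ∫⁻ k : ℤ, ENNReal.ofReal ((k : ℝ) ^ 2) ∂μ := by
  rw [lintegral_countable', moment]
  congr 1
  ext k
  rw [Real.rpow_two, sq_abs]

lemma integrable_sq_of_moment {μ : Measure ℤ} (h : moment 2 μ ≠ ∞) :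
    Integrable (fun k : ℤ => (k : ℝ) ^ 2) μ := by
  rw [moment_two_eq] at h
  exact (lintegral_ofReal_ne_top_iff_integrable (by fun_prop)
    (ae_of_all _ fun k => sq_nonneg _)).1 h

lemma moment_two_eq_ofReal {μ : Measure ℤ} (h : moment 2 μ ≠ ∞) :
    moment 2 μ = ENNReal.ofReal (variance μ) := by
  rw [moment_two_eq, variance, ofReal_integral_eq_lintegral_ofReal (integrable_sq_of_moment h)
    (ae_of_all _ fun k => sq_nonneg _)]

lemma isProbabilityMeasure_convProd {ν : ℕ → Measure ℤ} (hprob : ∀ n, IsProbabilityMeasure (ν n))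
    (n : ℕ) : IsProbabilityMeasure (convProd ν n) := by
  induction n with
  | zero => exact Measure.dirac.isProbabilityMeasure
  | succ n ih =>
    have := hprob n
    unfold convProd
    infer_instance

lemma integrable_sq_convProd {ν : ℕ → Measure ℤ} (hprob : ∀ n, IsProbabilityMeasure (ν n))
    (hint : ∀ n, Integrable (fun k : ℤ => (k : ℝ) ^ 2) (ν n)) (n : ℕ) :
    Integrable (fun k : ℤ => (k : ℝ) ^ 2) (convProd ν n) := by
  induction n with
  | zero => exact integrable_dirac (by simp)
  | succ n ih =>
    have := hprob n
    have := isProbabilityMeasure_convProd hprob n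
    exact integrable_sq_conv ih (hint n)

/-- The bound `exp(-C t² (n - N₀ - 1)⁺)` of the Fourier transform of the `n`-fold convolution, only
the factors with index larger than `N₀` being counted. -/
def gaussianBound (C : ℝ) (N₀ n : ℕ) (t : ℝ) : ℝ :=
  Real.exp (-C * t ^ 2 * ((n - (N₀ + 1) : ℕ) : ℝ))

lemma gaussianBound_succ_of_le {C : ℝ} {N₀ n : ℕ} (h : n ≤ N₀) (t : ℝ) :
    gaussianBound C N₀ (n + 1) t = gaussianBound C N₀ n t := by
  unfold gaussianBound
  rw [Nat.sub_eq_zero_of_le (by omega), Nat.sub_eq_zero_of_le (by omega)]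

lemma gaussianBound_succ_of_lt {C : ℝ} {N₀ n : ℕ} (h : N₀ < n) (t : ℝ) :
    gaussianBound C N₀ (n + 1) t = gaussianBound C N₀ n t * Real.exp (-C * t ^ 2) := by
  unfold gaussianBound
  rw [← Real.exp_add, show n + 1 - (N₀ + 1) = n - (N₀ + 1) + 1 by omega]
  push_cast
  ring_nf

lemma gaussianBound_pos (C : ℝ) (N₀ n : ℕ) (t : ℝ) : 0 < gaussianBound C N₀ n t :=
  Real.exp_pos _

lemma sq_le_quarter {t : ℝ} (ht : t ∈ Set.Ico (-(1 / 2) : ℝ) (1 / 2)) : t ^ 2 ≤ 1 / 4 := by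
  nlinarith [ht.1, ht.2]

lemma gaussianBound_le_mul_succ {C : ℝ} (hC : 0 < C) (N₀ n : ℕ) {t : ℝ}
    (ht : t ∈ Set.Ico (-(1 / 2) : ℝ) (1 / 2)) :
    gaussianBound C N₀ n t ≤ Real.exp C * gaussianBound C N₀ (n + 1) t := by
  unfold gaussianBound
  rw [← Real.exp_add, Real.exp_le_exp]
  have h1 : ((n + 1 - (N₀ + 1) : ℕ) : ℝ) ≤ ((n - (N₀ + 1) : ℕ) : ℝ) + 1 := by
    exact_mod_cast (by omega : n + 1 - (N₀ + 1) ≤ n - (N₀ + 1) + 1)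
  have h2 := sq_le_quarter ht
  nlinarith [mul_nonneg hC.le (sq_nonneg t),
    mul_le_mul_of_nonneg_left h1 (mul_nonneg hC.le (sq_nonneg t))]

lemma gaussianBound_le {C : ℝ} (hC : 0 < C) (N₀ n : ℕ) {t : ℝ}
    (ht : t ∈ Set.Ico (-(1 / 2) : ℝ) (1 / 2)) :
    gaussianBound C N₀ n t ≤ Real.exp (C * (N₀ + 1)) * Real.exp (-(C * n) * t ^ 2) := by
  unfold gaussianBound
  rw [← Real.exp_add, Real.exp_le_exp]
  have h1 : (n : ℝ) ≤ ((n - (N₀ + 1) : ℕ) : ℝ) + (N₀ + 1) := by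
    exact_mod_cast (by omega : n ≤ n - (N₀ + 1) + (N₀ + 1))
  have h2 := sq_le_quarter ht
  have h3 : (0 : ℝ) ≤ C * (N₀ + 1) := by positivity
  nlinarith [mul_le_mul_of_nonneg_left h1 (mul_nonneg hC.le (sq_nonneg t)),
    mul_le_mul_of_nonneg_left h2 h3]

/-- Bounds for the Fourier transform of a convolution product and its first two derivatives. At
most two factors are differentiated, each costing `exp C`; a factor differentiated once contributes
`2π|t|` times its variance, because its mean vanishes. -/
lemma norm_momentTransform_convProd_le {ν : ℕ → Measure ℤ}
    (hprob : ∀ n, IsProbabilityMeasure (ν n))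
    (hint : ∀ n, Integrable (fun k : ℤ => (k : ℝ) ^ 2) (ν n))
    (hmean : ∀ n, expectation (ν n) = 0) {C : ℝ} (hC : 0 < C) {N₀ : ℕ}
    (hF : ∀ n > N₀, ∀ t ∈ Set.Ico (-(1 / 2) : ℝ) (1 / 2),
      ‖fourierTransform (ν n) t‖ ≤ Real.exp (-C * t ^ 2))
    {t : ℝ} (ht : t ∈ Set.Ico (-(1 / 2) : ℝ) (1 / 2)) (n : ℕ) :
    ‖momentTransform 0 (convProd ν n) t‖ ≤ gaussianBound C N₀ n t ∧
    ‖momentTransform 1 (convProd ν n) t‖ ≤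
      Real.exp C * gaussianBound C N₀ n t *
        (2 * Real.pi * |t| * ∑ i ∈ Finset.range n, variance (ν i)) ∧
    ‖momentTransform 2 (convProd ν n) t‖ ≤
      gaussianBound C N₀ n t * (Real.exp C * ∑ i ∈ Finset.range n, variance (ν i) +
        (Real.exp C * (2 * Real.pi * |t| * ∑ i ∈ Finset.range n, variance (ν i))) ^ 2) := by
  induction n with
  | zero => simp [momentTransform, convProd, gaussianBound, norm_phase]
  | succ n ih =>
    obtain ⟨ih0, ih1, ih2⟩ := ih
    have := hprob n
    have := isProbabilityMeasure_convProd hprob n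
    have hi := integrable_sq_convProd hprob hint n
    have e0 : convProd ν (n + 1) = (convProd ν n).conv (ν n) := rfl
    rw [e0, momentTransform_conv_zero, momentTransform_conv_one hi (hint n),
      momentTransform_conv_two hi (hint n), Finset.sum_range_succ]
    set M := ∑ i ∈ Finset.range n, variance (ν i)
    have hM : 0 ≤ M := Finset.sum_nonneg fun i _ => variance_nonneg _
    have hv := variance_nonneg (ν n)
    have hG := gaussianBound_pos C N₀ n t
    have hG' := gaussianBound_pos C N₀ (n + 1) t
    have hGD := gaussianBound_le_mul_succ hC N₀ n ht
    have h1 := norm_momentTransform_one_le (hint n) (hmean n) t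
    have h2 := norm_momentTransform_two_le (ν n) t
    change _ ≤ _ * variance (ν n) at h1
    change _ ≤ variance (ν n) at h2
    have hD := Real.exp_pos C
    set L := 2 * Real.pi * |t|
    have hL : 0 ≤ L := by positivity
    set G := gaussianBound C N₀ n t
    set G' := gaussianBound C N₀ (n + 1) t
    set D := Real.exp C
    set v := variance (ν n)
    -- multiplication by the transform of the next factor turns the bound `G` into `G'`
    have step : ∀ z : ℝ, 0 ≤ z → G * z * ‖momentTransform 0 (ν n) t‖ ≤ G' * z := by
      intro z hz
      have : G * ‖momentTransform 0 (ν n) t‖ ≤ G' := by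
        rcases Nat.lt_or_ge N₀ n with h | h
        · rw [show G' = G * Real.exp (-C * t ^ 2) from gaussianBound_succ_of_lt h t,
            momentTransform_zero _ (hint n)]
          exact mul_le_mul_of_nonneg_left (hF n h t ht) hG.le
        · rw [show G' = G from gaussianBound_succ_of_le h t]
          exact mul_le_of_le_one_right hG.le (norm_momentTransform_zero_le _ t)
      nlinarith
    have n0 := norm_nonneg (momentTransform 0 (ν n) t)
    have n1 := norm_nonneg (momentTransform 1 (ν n) t)
    have n2 := norm_nonneg (momentTransform 2 (ν n) t)
    refine ⟨?_, ?_, ?_⟩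
    · rw [norm_mul]
      calc _ ≤ G * ‖momentTransform 0 (ν n) t‖ := by gcongr
        _ ≤ G' := by simpa using step 1 zero_le_one
    · calc _ ≤ ‖momentTransform 1 (convProd ν n) t‖ * ‖momentTransform 0 (ν n) t‖ +
            ‖momentTransform 0 (convProd ν n) t‖ * ‖momentTransform 1 (ν n) t‖ := by
            rw [← norm_mul, ← norm_mul]
            exact norm_add_le _ _
        _ ≤ D * G * (L * M) * ‖momentTransform 0 (ν n) t‖ + (D * G') * (L * v) := by
            gcongr
            exact ih0.trans hGD
        _ ≤ D * G' * (L * M) + (D * G') * (L * v) := by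
            have := step (D * (L * M)) (by positivity)
            linarith
        _ = _ := by ring
    · calc _ ≤ ‖momentTransform 2 (convProd ν n) t‖ * ‖momentTransform 0 (ν n) t‖ +
            2 * (‖momentTransform 1 (convProd ν n) t‖ * ‖momentTransform 1 (ν n) t‖) +
            ‖momentTransform 0 (convProd ν n) t‖ * ‖momentTransform 2 (ν n) t‖ := by
            refine (norm_add₃_le).trans (le_of_eq ?_)
            simp only [norm_mul, Complex.norm_two]
        _ ≤ G * (D * M + (D * (L * M)) ^ 2) * ‖momentTransform 0 (ν n) t‖ +
            2 * (D * (D * G') * (L * M) * (L * v)) + (D * G') * v := by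
            have : D * G * (L * M) ≤ D * (D * G') * (L * M) := by gcongr
            gcongr
            · exact ih1.trans this
            · exact ih0.trans hGD
        _ ≤ G' * (D * M + (D * (L * M)) ^ 2) +
            2 * (D * (D * G') * (L * M) * (L * v)) + (D * G') * v := by
            have := step (D * M + (D * (L * M)) ^ 2) (by positivity)
            linarith
        _ ≤ _ := by
            have : 0 ≤ G' * (D * (L * v)) ^ 2 := by positivity
            nlinarith

/-- For a convolution product `μ_n` of `n` measures with variances summing to `O(n)`, uniformly in
`k`: `μ_n(k) = O(n^{-1/2})`, `k² μ_n(k) = O(n^{1/2})` and `μ_n(k+1) - μ_n(k) = O(n⁻¹)`. -/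
theorem exists_kernel_bounds {ν : ℕ → Measure ℤ}
    (hprob : ∀ n, IsProbabilityMeasure (ν n))
    (hint : ∀ n, Integrable (fun k : ℤ => (k : ℝ) ^ 2) (ν n))
    (hmean : ∀ n, expectation (ν n) = 0) {C : ℝ} (hC : 0 < C) {N₀ : ℕ}
    (hF : ∀ n > N₀, ∀ t ∈ Set.Ico (-(1 / 2) : ℝ) (1 / 2),
      ‖fourierTransform (ν n) t‖ ≤ Real.exp (-C * t ^ 2))
    {K : ℝ} (hK : 0 ≤ K) {n₁ : ℕ} (hn₁ : 1 ≤ n₁)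
    (hM : ∀ n ≥ n₁, ∑ i ∈ Finset.range n, variance (ν i) ≤ K * n) :
    ∃ A > 0, ∀ n ≥ n₁, ∀ k : ℤ,
      (convProd ν n).real {k} ≤ A / √n ∧
      (k : ℝ) ^ 2 * (convProd ν n).real {k} ≤ A * √n ∧
      |(convProd ν n).real {k + 1} - (convProd ν n).real {k}| ≤ A / n := by
  set D := Real.exp C
  set E := Real.exp (C * (N₀ + 1))
  have hD : 0 < D := Real.exp_pos _
  have hE : 0 < E := Real.exp_pos _
  set P := √(Real.pi / (C / 2))
  have hP : 0 < P := Real.sqrt_pos.2 (by positivity)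
  set A₂ := E * (D * K + (D * (2 * Real.pi * K)) ^ 2 * (2 / C))
  set A₁ := 2 * Real.pi * E * (1 + 2 / C)
  have hA₂ : 0 ≤ A₂ := by positivity
  have hA₁ : 0 ≤ A₁ := by positivity
  refine ⟨E * P + A₂ * P + A₁ * P, by positivity, fun n hn k => ?_⟩
  have hn0 : (0 : ℝ) < n := by exact_mod_cast (by omega : 0 < n)
  have hs : 0 < √(n : ℝ) := Real.sqrt_pos.2 hn0
  have hss : √(n : ℝ) * √n = n := Real.mul_self_sqrt hn0.le
  have := isProbabilityMeasure_convProd hprob n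
  have hi := integrable_sq_convProd hprob hint n
  have hb : 0 < C / 2 * n := by positivity
  have hPn : √(Real.pi / (C / 2 * n)) = P / √n := by
    rw [← div_div, Real.sqrt_div (by positivity)]
  have bounds := fun t ht => norm_momentTransform_convProd_le hprob hint hmean hC hF (t := t) ht n
  set M := ∑ i ∈ Finset.range n, variance (ν i)
  have hM0 : 0 ≤ M := Finset.sum_nonneg fun i _ => variance_nonneg _
  have hMn : M ≤ K * n := hM n hn
  set Q : ℝ → ℝ := fun t => Real.exp (-(C / 2 * n) * t ^ 2)
  have hQ : ∀ t, 0 < Q t := fun t => Real.exp_pos _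
  have hQ1 : ∀ t, Q t ≤ 1 := fun t => by
    refine Real.exp_le_one_iff.2 ?_
    nlinarith [mul_nonneg hb.le (sq_nonneg t)]
  -- `x e^{-x} ≤ 1` with `x = C n t² / 2`, so that half of the Gaussian absorbs `n t²`
  have habs : ∀ t : ℝ, n * t ^ 2 * Q t ≤ 2 / C := fun t => by
    have h1 := Real.add_one_le_exp (C / 2 * n * t ^ 2)
    have h2 : Real.exp (C / 2 * n * t ^ 2) * Q t = 1 := by
      rw [← Real.exp_add]; simp
    have h3 : C / 2 * n * t ^ 2 * Q t ≤ 1 := by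
      rw [← h2]
      exact mul_le_mul_of_nonneg_right (by linarith) (hQ t).le
    rw [le_div_iff₀ hC]
    linarith
  have hG : ∀ t ∈ Set.Ico (-(1 / 2) : ℝ) (1 / 2), gaussianBound C N₀ n t ≤ E * (Q t * Q t) := by
    intro t ht
    refine (gaussianBound_le hC N₀ n ht).trans (le_of_eq ?_)
    rw [← Real.exp_add (-(C / 2 * n) * t ^ 2)]
    congr 2
    ring
  have F0 : ∀ t ∈ Set.Ico (-(1 / 2) : ℝ) (1 / 2),
      ‖momentTransform 0 (convProd ν n) t‖ ≤ E * (Q t * Q t) :=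
    fun t ht => (bounds t ht).1.trans (hG t ht)
  have hpow : ∀ t, Q t * Q t ≤ Q t := fun t => mul_le_of_le_one_right (hQ t).le (hQ1 t)
  refine ⟨?_, ?_, ?_⟩
  · have h1 := norm_integral_le_of_gaussian_bound (E := E) hb hE.le
      (F := fun t => momentTransform 0 (convProd ν n) t * phase (-k) t) (fun t ht => by
        rw [norm_mul, norm_phase, mul_one]
        exact (F0 t ht).trans (mul_le_mul_of_nonneg_left (hpow t) hE.le))
    rw [integral_momentTransform_mul_phase hi (by norm_num), hPn] at h1
    rw [pow_zero, one_mul, Complex.norm_real, Real.norm_eq_abs,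
      abs_of_nonneg measureReal_nonneg] at h1
    refine h1.trans ?_
    rw [← mul_div_assoc]
    gcongr
    nlinarith [mul_nonneg hA₂ hP.le, mul_nonneg hA₁ hP.le]
  · have h1 := norm_integral_le_of_gaussian_bound (E := A₂ * n) hb (by positivity)
      (F := fun t => momentTransform 2 (convProd ν n) t * phase (-k) t) (fun t ht => by
        rw [norm_mul, norm_phase, mul_one]
        refine (bounds t ht).2.2.trans ?_
        have e1 : (D * (2 * Real.pi * |t| * M)) ^ 2 ≤
            (D * (2 * Real.pi * K)) ^ 2 * n * (n * t ^ 2) := by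
          calc _ ≤ (D * (2 * Real.pi * |t| * (K * n))) ^ 2 := by gcongr
            _ = _ := by rw [← sq_abs t]; ring
        calc _ ≤ E * (Q t * Q t) * (D * (K * n) +
              (D * (2 * Real.pi * K)) ^ 2 * n * (n * t ^ 2)) := by
              gcongr
              exact hG t ht
          _ = E * n * Q t * (D * K * Q t + (D * (2 * Real.pi * K)) ^ 2 * (n * t ^ 2 * Q t)) := by
              ring
          _ ≤ E * n * Q t * (D * K * 1 + (D * (2 * Real.pi * K)) ^ 2 * (2 / C)) := by
              have := (hQ t).le
              gcongr
              · exact hQ1 t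
              · exact habs t
          _ = _ := by ring)
    rw [integral_momentTransform_mul_phase hi (by norm_num), hPn] at h1
    rw [norm_mul, norm_pow, Complex.norm_intCast, sq_abs, Complex.norm_real, Real.norm_eq_abs,
      abs_of_nonneg measureReal_nonneg] at h1
    refine h1.trans ?_
    have : A₂ * n * (P / √n) = A₂ * P * √n := by
      calc _ = A₂ * P * (n / √n) := by ring
        _ = _ := by rw [Real.div_sqrt]
    rw [this]
    gcongr
    nlinarith [mul_nonneg hE.le hP.le, mul_nonneg hA₁ hP.le]
  · -- the difference has transform `F_0(t) (e^{-2πit} - 1) e^{-2πikt}`, and a factor `|t|` gains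
    -- `n^{-1/2}` over the bound for `μ_n(k)`
    have hc : ∀ j : ℤ, IntervalIntegrable
        (fun t => momentTransform 0 (convProd ν n) t * phase (-j) t) volume (-(1 / 2)) (1 / 2) := by
      intro j
      refine Continuous.intervalIntegrable (Continuous.mul ?_ (continuous_phase _)) _ _
      unfold momentTransform
      refine continuous_of_dominated (bound := fun _ => 1) (fun t => by fun_prop) (fun t => ?_)
        (integrable_const 1) ?_
      · exact ae_of_all _ fun k => by simp [norm_phase]
      · exact ae_of_all _ fun k => (continuous_phase k).const_mul _
    have h1 := norm_integral_le_of_gaussian_bound (E := A₁ / √n) hb (by positivity)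
      (F := fun t => momentTransform 0 (convProd ν n) t * phase (-(k + 1)) t -
        momentTransform 0 (convProd ν n) t * phase (-k) t) (fun t ht => by
        have e1 : momentTransform 0 (convProd ν n) t * phase (-(k + 1)) t -
            momentTransform 0 (convProd ν n) t * phase (-k) t =
            momentTransform 0 (convProd ν n) t * phase (-k) t * (phase (-1) t - 1) := by
          rw [neg_add, phase_add]; ring
        have e2 : ‖phase (-1) t - 1‖ ≤ 2 * Real.pi * |t| := by
          simpa using norm_phase_sub_one_le (-1) t
        have e3 : √n * |t| * Q t ≤ 1 + 2 / C := by
          have : √n * |t| ≤ 1 + n * t ^ 2 := by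
            rw [← sq_abs t]
            nlinarith [sq_nonneg (√n * |t| - 1), sq_nonneg (√n * |t|)]
          nlinarith [habs t, hQ1 t, hQ t, mul_le_mul_of_nonneg_right this (hQ t).le]
        rw [e1, norm_mul, norm_mul, norm_phase, mul_one]
        calc _ ≤ E * (Q t * Q t) * (2 * Real.pi * |t|) := by
              have := hQ t
              gcongr
              exact F0 t ht
          _ = 2 * Real.pi * E * (√n * |t| * Q t) / √n * Q t := by field_simp
          _ ≤ 2 * Real.pi * E * (1 + 2 / C) / √n * Q t := by
              have := (hQ t).le
              gcongr
          _ = _ := rfl)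
    rw [intervalIntegral.integral_sub (hc _) (hc _),
      integral_momentTransform_mul_phase hi (by norm_num),
      integral_momentTransform_mul_phase hi (by norm_num), hPn, pow_zero, pow_zero, one_mul,
      one_mul, ← Complex.ofReal_sub, Complex.norm_real, Real.norm_eq_abs] at h1
    refine h1.trans ?_
    rw [div_mul_div_comm, hss]
    gcongr
    nlinarith [mul_nonneg hE.le hP.le, mul_nonneg hA₂ hP.le]


/-! ### The maximal ergodic inequality -/

section maximal

variable {X : Type*}

/-- The maximum of the Birkhoff sums of `g` along `T` of length at most `N`, the empty sum
included, in the recursive form used in Garsia's argument. -/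
def maxBirkhoffSum (T : X → X) (g : X → ℝ) : ℕ → X → ℝ
  | 0, _ => 0
  | N + 1, x => max 0 (g x + maxBirkhoffSum T g N (T x))

lemma maxBirkhoffSum_nonneg (T : X → X) (g : X → ℝ) (N : ℕ) (x : X) :
    0 ≤ maxBirkhoffSum T g N x := by
  cases N with
  | zero => exact le_rfl
  | succ N => exact le_max_left _ _

lemma maxBirkhoffSum_le_succ (T : X → X) (g : X → ℝ) (N : ℕ) (x : X) :
    maxBirkhoffSum T g N x ≤ maxBirkhoffSum T g (N + 1) x := by
  induction N generalizing x with
  | zero => exact le_max_left _ _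
  | succ N ih =>
    unfold maxBirkhoffSum
    gcongr
    exact ih (T x)

lemma birkhoffSum_le_maxBirkhoffSum (T : X → X) (g : X → ℝ) (N : ℕ) (x : X) :
    birkhoffSum T g N x ≤ maxBirkhoffSum T g N x := by
  induction N generalizing x with
  | zero => simp [maxBirkhoffSum]
  | succ N ih =>
    rw [birkhoffSum_succ']
    exact le_max_of_le_right (by gcongr; exact ih (T x))

variable [MeasurableSpace X] {m : Measure X}

lemma integrable_maxBirkhoffSum {T : X → X} (hT : MeasurePreserving T m m) {g : X → ℝ}
    (hg : Integrable g m) (N : ℕ) : Integrable (maxBirkhoffSum T g N) m := by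
  induction N with
  | zero => exact integrable_zero _ _ _
  | succ N ih => exact (integrable_zero _ _ _).sup (hg.add (hT.integrable_comp_of_integrable ih))

/-- Hopf's maximal ergodic theorem, by Garsia's argument: with `R` the maximum of the Birkhoff
sums, `R - R ∘ T ≤ g` wherever `R > 0`, and the left-hand side has integral zero. -/
theorem integral_indicator_maxBirkhoffSum_nonneg {T : X → X} (hT : MeasurePreserving T m m)
    {g : X → ℝ} (hg : Integrable g m) (N : ℕ) :
    0 ≤ ∫ x, Set.indicator {x | 0 < maxBirkhoffSum T g N x} g x ∂m := by
  have hR := integrable_maxBirkhoffSum hT hg N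
  have hRT := hT.integrable_comp_of_integrable hR
  have hA : NullMeasurableSet {x | 0 < maxBirkhoffSum T g N x} m :=
    nullMeasurableSet_lt aemeasurable_const hR.aemeasurable
  have h0 : ∫ x, (maxBirkhoffSum T g N x - maxBirkhoffSum T g N (T x)) ∂m = 0 := by
    have h1 : ∫ x, maxBirkhoffSum T g N (T x) ∂m = ∫ x, maxBirkhoffSum T g N x ∂m := by
      have := integral_map hT.aemeasurable (f := maxBirkhoffSum T g N)
        (by rw [hT.map_eq]; exact hR.aestronglyMeasurable)
      rw [← this, hT.map_eq]
    have h2 := integral_sub hR hRT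
    simp only [Function.comp_apply, h1, sub_self] at h2
    exact h2
  refine h0.symm.le.trans (integral_mono (hR.sub hRT) (hg.indicator₀ hA) fun x => ?_)
  by_cases hx : 0 < maxBirkhoffSum T g N x
  · simp only [Set.indicator, Set.mem_ofPred_eq, hx, if_true]
    cases N with
    | zero => exact absurd hx (lt_irrefl _)
    | succ N =>
      have h1 : maxBirkhoffSum T g (N + 1) x = g x + maxBirkhoffSum T g N (T x) := by
        rcases max_choice 0 (g x + maxBirkhoffSum T g N (T x)) with h | h
        · exact absurd h (ne_of_gt hx)
        · exact h
      have h2 := maxBirkhoffSum_le_succ T g N (T x)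
      linarith
  · simp only [Set.indicator, Set.mem_ofPred_eq, hx, if_false]
    have := maxBirkhoffSum_nonneg T g N (T x)
    linarith

/-- The weak type `(1, 1)` inequality for one-sided ergodic averages. -/
theorem measure_exists_lt_birkhoffSum_le [IsFiniteMeasure m] {T : X → X}
    (hT : MeasurePreserving T m m) {f : X → ℝ} (hf : Integrable f m) (h0 : ∀ x, 0 ≤ f x) {α : ℝ}
    (hα : 0 < α) :
    m {x | ∃ n : ℕ, α * n < birkhoffSum T f n x} ≤ ENNReal.ofReal ((∫ x, f x ∂m) / α) := by
  set g : X → ℝ := fun x => f x - α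
  have hg : Integrable g m := hf.sub (integrable_const α)
  set A : ℕ → Set X := fun N => {x | 0 < maxBirkhoffSum T g N x}
  have hsub : {x | ∃ n : ℕ, α * n < birkhoffSum T f n x} ⊆ ⋃ N, A N := by
    rintro x ⟨n, hn⟩
    refine Set.mem_iUnion.2 ⟨n, lt_of_lt_of_le ?_ (birkhoffSum_le_maxBirkhoffSum T g n x)⟩
    have : birkhoffSum T g n x = birkhoffSum T f n x - n * α := by
      simp [birkhoffSum, g, Finset.sum_sub_distrib]
    rw [this]
    linarith
  have hmono : Monotone A :=
    monotone_nat_of_le_succ fun N x hx => lt_of_lt_of_le hx (maxBirkhoffSum_le_succ T g N x)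
  refine (measure_mono hsub).trans ?_
  rw [hmono.measure_iUnion]
  refine iSup_le fun N => ?_
  have hA : NullMeasurableSet (A N) m :=
    nullMeasurableSet_lt aemeasurable_const (integrable_maxBirkhoffSum hT hg N).aemeasurable
  have h1 := integral_indicator_maxBirkhoffSum_nonneg hT hg N
  change 0 ≤ ∫ x, (A N).indicator g x ∂m at h1
  rw [integral_indicator₀ hA, integral_sub hf.integrableOn (integrable_const α).integrableOn,
    setIntegral_const, smul_eq_mul] at h1
  have h2 : ∫ x in A N, f x ∂m ≤ ∫ x, f x ∂m :=
    setIntegral_le_integral hf (ae_of_all _ h0)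
  rw [← ofReal_measureReal]
  refine ENNReal.ofReal_le_ofReal ?_
  rw [le_div_iff₀ hα]
  linarith

end maximal

/-! ### Domination of the kernels by ergodic averages -/

/-- Abel summation: if the averages of `a` are at most `A`, then so are its averages with respect
to a decreasing weight. -/
lemma sum_mul_le_of_antitone {φ a : ℕ → ℝ} (hφ : Antitone φ) (h0 : ∀ k, 0 ≤ φ k) {A : ℝ}
    (hA : ∀ n : ℕ, ∑ i ∈ Finset.range n, a i ≤ A * n) (n : ℕ) :
    ∑ k ∈ Finset.range n, φ k * a k ≤ A * ∑ k ∈ Finset.range n, φ k := by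
  -- the boundary term of the summation by parts is kept, to make the induction close
  have key : ∑ k ∈ Finset.range n, φ k * a k ≤ A * ∑ k ∈ Finset.range n, φ k +
      φ n * (∑ i ∈ Finset.range n, a i - A * n) := by
    induction n with
    | zero => simp
    | succ n ih =>
      have h1 := hA (n + 1)
      have h2 := hφ (Nat.le_succ n)
      rw [Finset.sum_range_succ] at h1
      rw [Finset.sum_range_succ, Finset.sum_range_succ, Finset.sum_range_succ]
      push_cast at h1 ⊢
      change φ (n + 1) ≤ φ n at h2
      nlinarith
  nlinarith [h0 n, hA n]

/-- The decreasing weight `s / (s + k)²`, which has mass `O(1)` at scale `s`. -/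
def decayWeight (s : ℝ) (k : ℕ) : ℝ := s / (s + k) ^ 2

lemma decayWeight_nonneg {s : ℝ} (hs : 0 ≤ s) (k : ℕ) : 0 ≤ decayWeight s k := by
  unfold decayWeight
  positivity

lemma antitone_decayWeight {s : ℝ} (hs : 0 < s) : Antitone (decayWeight s) := by
  intro j k hjk
  unfold decayWeight
  gcongr

lemma sum_decayWeight_le {s : ℝ} (hs : 1 ≤ s) (n : ℕ) :
    ∑ k ∈ Finset.range n, decayWeight s k ≤ 2 := by
  have key : ∀ n : ℕ, ∑ k ∈ Finset.range (n + 1), decayWeight s k ≤ 2 - s / (s + n) := by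
    intro n
    induction n with
    | zero =>
      have : s / s ^ 2 ≤ 1 := by
        rw [div_le_one (by positivity)]
        nlinarith
      simp [decayWeight, div_self (by positivity : s ≠ 0)]
      linarith
    | succ n ih =>
      rw [Finset.sum_range_succ]
      -- comparison with a telescoping series
      have : decayWeight s (n + 1) ≤ s / (s + n) - s / (s + (n + 1 : ℕ)) := by
        unfold decayWeight
        have h1 : 0 < s + n := by positivity
        rw [div_sub_div _ _ (by positivity) (by positivity),
          div_le_div_iff₀ (by positivity) (by positivity)]
        push_cast
        nlinarith [mul_pos (by positivity : 0 < s) (by positivity : 0 < s + (n + 1))]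
      linarith
  cases n with
  | zero => simp
  | succ n =>
    have : 0 ≤ s / (s + n) := by positivity
    linarith [key n]

lemma summable_and_tsum_le_of_decay {s A α : ℝ} (hs : 1 ≤ s) (hA : 0 ≤ A) (hα : 0 ≤ α)
    {w a : ℕ → ℝ} (hw0 : ∀ k, 0 ≤ w k) (hw : ∀ k, w k ≤ A * decayWeight s k) (ha : ∀ k, 0 ≤ a k)
    (havg : ∀ n : ℕ, ∑ i ∈ Finset.range n, a i ≤ α * n) :
    Summable (fun k => w k * a k) ∧ ∑' k, w k * a k ≤ 2 * A * α := by
  have hb : ∀ n, ∑ k ∈ Finset.range n, w k * a k ≤ 2 * A * α := fun n =>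
    calc _ ≤ ∑ k ∈ Finset.range n, A * (decayWeight s k * a k) :=
          Finset.sum_le_sum fun k _ => by
            rw [← mul_assoc]
            exact mul_le_mul_of_nonneg_right (hw k) (ha k)
      _ = A * ∑ k ∈ Finset.range n, decayWeight s k * a k := by rw [Finset.mul_sum]
      _ ≤ A * (α * 2) := by
          gcongr
          refine (sum_mul_le_of_antitone (antitone_decayWeight (by linarith))
            (decayWeight_nonneg (by linarith)) havg n).trans ?_
          gcongr
          exact sum_decayWeight_le hs n
      _ = _ := by ring
  have hn : ∀ k, 0 ≤ w k * a k := fun k => mul_nonneg (hw0 k) (ha k)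
  exact ⟨summable_of_sum_range_le hn hb, Real.tsum_le_of_sum_range_le hn hb⟩

/-- A kernel on `ℤ` bounded by a two-sided `decayWeight` is dominated by the one-sided averages in
the two directions. -/
lemma tsum_le_of_decay {s A α : ℝ} (hs : 1 ≤ s) (hA : 0 ≤ A) (hα : 0 ≤ α)
    {w a : ℤ → ℝ} (hw0 : ∀ k, 0 ≤ w k) (hw : ∀ k, w k ≤ A * decayWeight s k.natAbs)
    (ha : ∀ k, 0 ≤ a k)
    (hpos : ∀ n : ℕ, ∑ i ∈ Finset.range n, a i ≤ α * n)
    (hneg : ∀ n : ℕ, ∑ i ∈ Finset.range n, a (-i) ≤ α * n) :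
    ∑' k, w k * a k ≤ 4 * A * α := by
  obtain ⟨s1, t1⟩ := summable_and_tsum_le_of_decay hs hA hα (w := fun k : ℕ => w k)
    (a := fun k : ℕ => a k) (fun k => hw0 k) (fun k => by simpa using hw k) (fun k => ha k) hpos
  obtain ⟨s2, t2⟩ := summable_and_tsum_le_of_decay hs hA hα (w := fun k : ℕ => w (-k))
    (a := fun k : ℕ => a (-k)) (fun k => hw0 _) (fun k => by simpa using hw (-k)) (fun k => ha _)
    hneg
  rw [Summable.tsum_of_nat_of_neg (f := fun k : ℤ => w k * a k) s1 s2]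
  have := mul_nonneg (hw0 0) (ha 0)
  linarith

lemma le_decayWeight_of_bounds {s A p : ℝ} (hs : 0 < s) (hp : 0 ≤ p) (k : ℤ) (h1 : p ≤ A / s)
    (h2 : (k : ℝ) ^ 2 * p ≤ A * s) : p ≤ 4 * A * decayWeight s k.natAbs := by
  have hk : ((k.natAbs : ℕ) : ℝ) = |(k : ℝ)| := by
    rw [Nat.cast_natAbs, Int.cast_abs]
  unfold decayWeight
  rw [hk, ← mul_div_assoc, le_div_iff₀ (by positivity)]
  rw [le_div_iff₀ hs] at h1
  have h3 : (s + |(k : ℝ)|) ^ 2 ≤ 2 * (s ^ 2 + (k : ℝ) ^ 2) := by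
    rw [← sq_abs (k : ℝ)]
    nlinarith [sq_nonneg (s - |(k : ℝ)|)]
  nlinarith [mul_le_mul_of_nonneg_left h3 hp, mul_le_mul_of_nonneg_right h1 hs.le]

/-! ### Asymptotic translation invariance of the kernels -/

lemma summable_one_add_sq_rpow :
    Summable fun k : ℤ => (1 + (k : ℝ) ^ 2) ^ (-(3 / 5) : ℝ) := by
  refine Summable.of_norm_bounded_eventually
    (Real.summable_abs_int_rpow (b := 6 / 5) (by norm_num)) ?_
  rw [Filter.eventually_cofinite]
  refine (Set.finite_singleton (0 : ℤ)).subset fun k hk => ?_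
  by_contra h0
  refine hk ?_
  have hk0 : 0 < |(k : ℝ)| := abs_pos.2 (by exact_mod_cast h0)
  rw [Real.norm_eq_abs, abs_of_nonneg (by positivity)]
  calc (1 + (k : ℝ) ^ 2) ^ (-(3 / 5) : ℝ) ≤ (|(k : ℝ)| ^ (2 : ℝ)) ^ (-(3 / 5) : ℝ) := by
        refine Real.rpow_le_rpow_of_nonpos (by positivity) ?_ (by norm_num)
        rw [Real.rpow_two, sq_abs]
        linarith
    _ = _ := by
        rw [← Real.rpow_mul hk0.le]
        norm_num

/-- The weighted geometric mean, with exponents `2/5` and `3/5`, of the bounds `d = O(1/n)` and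
`(1 + k²) d = O(√n)`: it is summable in `k` and tends to zero with `n`. -/
lemma le_rpow_of_bounds {A d x y : ℝ} (hA : 0 ≤ A) (hd : 0 ≤ d) (hx : 0 < x) (hy : 0 < y)
    (h1 : d ≤ A / x) (h2 : y * d ≤ A * √x) :
    d ≤ A * x ^ (-(1 / 10) : ℝ) * y ^ (-(3 / 5) : ℝ) := by
  have h3 : d ≤ A * x ^ (1 / 2 : ℝ) * y⁻¹ := by
    rw [← Real.sqrt_eq_rpow, ← div_eq_mul_inv, le_div_iff₀ hy]
    linarith
  calc d = d ^ (2 / 5 : ℝ) * d ^ (3 / 5 : ℝ) := by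
        rw [← Real.rpow_add_of_nonneg hd (by norm_num) (by norm_num)]
        norm_num
    _ ≤ (A * x ^ (-1 : ℝ)) ^ (2 / 5 : ℝ) * (A * x ^ (1 / 2 : ℝ) * y⁻¹) ^ (3 / 5 : ℝ) := by
        rw [div_eq_mul_inv, ← Real.rpow_neg_one] at h1
        gcongr
    _ = (A ^ (2 / 5 : ℝ) * A ^ (3 / 5 : ℝ)) *
          ((x ^ (-1 : ℝ)) ^ (2 / 5 : ℝ) * (x ^ (1 / 2 : ℝ)) ^ (3 / 5 : ℝ)) *
          (y ^ (-1 : ℝ)) ^ (3 / 5 : ℝ) := by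
        rw [Real.mul_rpow hA (by positivity), Real.mul_rpow (by positivity) (by positivity),
          Real.mul_rpow hA (by positivity), ← Real.rpow_neg_one y]
        ring
    _ = _ := by
        rw [← Real.rpow_add_of_nonneg hA (by norm_num) (by norm_num), ← Real.rpow_mul hx.le,
          ← Real.rpow_mul hx.le, ← Real.rpow_mul hy.le, ← Real.rpow_add hx]
        norm_num

/-- The total variation of `μ_n - δ₁ ∗ μ_n` tends to zero for kernels satisfying the bounds of
`exists_kernel_bounds`. -/
lemma tendsto_tsum_abs_sub_of_bounds {p : ℕ → ℤ → ℝ} (hp : ∀ n k, 0 ≤ p n k) {A : ℝ} (hA : 0 ≤ A)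
    {n₁ : ℕ} (hn₁ : 1 ≤ n₁)
    (hb : ∀ n ≥ n₁, ∀ k : ℤ, p n k ≤ A / √n ∧ (k : ℝ) ^ 2 * p n k ≤ A * √n ∧
      |p n (k + 1) - p n k| ≤ A / n) :
    Tendsto (fun n => ∑' k, |p n (k + 1) - p n k|) atTop (𝓝 0) := by
  have hpt : ∀ n ≥ n₁, ∀ k : ℤ, |p n (k + 1) - p n k| ≤
      6 * A * (n : ℝ) ^ (-(1 / 10) : ℝ) * (1 + (k : ℝ) ^ 2) ^ (-(3 / 5) : ℝ) := by
    intro n hn k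
    have hn1 : (1 : ℝ) ≤ n := by exact_mod_cast hn₁.trans hn
    have hs : 1 ≤ √(n : ℝ) := Real.one_le_sqrt.2 hn1
    obtain ⟨a1, b1, c1⟩ := hb n hn k
    obtain ⟨a2, b2, -⟩ := hb n hn (k + 1)
    have d1 : A / n ≤ A := div_le_self hA hn1
    have d2 : A / √n ≤ A := div_le_self hA hs
    have d3 : A ≤ A * √n := le_mul_of_one_le_right hA hs
    refine le_rpow_of_bounds (by positivity) (abs_nonneg _) (by positivity) (by positivity) ?_ ?_
    · refine c1.trans ?_
      gcongr
      linarith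
    · have e1 : |p n (k + 1) - p n k| ≤ p n (k + 1) + p n k := by
        rw [abs_le]
        constructor <;> linarith [hp n k, hp n (k + 1)]
      have e2 : (k : ℝ) ^ 2 * p n (k + 1) ≤
          2 * (((k + 1 : ℤ) : ℝ) ^ 2 * p n (k + 1)) + 2 * p n (k + 1) := by
        push_cast
        nlinarith [mul_nonneg (sq_nonneg ((k : ℝ) + 2)) (hp n (k + 1))]
      have e3 := mul_le_mul_of_nonneg_left e1 (sq_nonneg (k : ℝ))
      nlinarith
  have hlim : Tendsto (fun n : ℕ => 6 * A * (n : ℝ) ^ (-(1 / 10) : ℝ) *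
      ∑' k : ℤ, (1 + (k : ℝ) ^ 2) ^ (-(3 / 5) : ℝ)) atTop (𝓝 0) := by
    have := (tendsto_rpow_neg_atTop (y := 1 / 10) (by norm_num)).comp
      (tendsto_natCast_atTop_atTop (R := ℝ))
    simpa using (this.const_mul (6 * A)).mul_const
      (∑' k : ℤ, (1 + (k : ℝ) ^ 2) ^ (-(3 / 5) : ℝ))
  refine tendsto_of_tendsto_of_tendsto_of_le_of_le' tendsto_const_nhds hlim
    (Eventually.of_forall fun n => tsum_nonneg fun k => abs_nonneg _) ?_
  filter_upwards [eventually_ge_atTop n₁] with n hn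
  rw [← tsum_mul_left]
  have hS := summable_one_add_sq_rpow.mul_left (6 * A * (n : ℝ) ^ (-(1 / 10) : ℝ))
  exact Summable.tsum_le_tsum (hpt n hn)
    (Summable.of_nonneg_of_le (fun k => abs_nonneg _) (hpt n hn) hS) hS


/-! ### Weighted averages along the orbits -/

section dynamics

variable {X : Type*} [MeasurableSpace X]

/-- The point `τ^k x`, `k ∈ ℤ`. -/
def orbit (τ : X ≃ᵐ X) (k : ℤ) (x : X) : X := ((τ.toEquiv : Equiv.Perm X) ^ k) x

lemma orbit_natCast (τ : X ≃ᵐ X) (n : ℕ) : orbit τ n = τ^[n] := by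
  ext x
  rw [orbit, zpow_natCast, ← Equiv.Perm.iterate_eq_pow]
  rfl

lemma orbit_neg_natCast (τ : X ≃ᵐ X) (n : ℕ) : orbit τ (-n) = τ.symm^[n] := by
  ext x
  rw [orbit, zpow_neg, zpow_natCast, ← inv_pow, ← Equiv.Perm.iterate_eq_pow]
  rfl

lemma orbit_add_one (τ : X ≃ᵐ X) (k : ℤ) (x : X) : orbit τ (k + 1) x = τ (orbit τ k x) := by
  rw [orbit, add_comm, zpow_add, zpow_one]
  rfl

variable {m : Measure X} {τ : X ≃ᵐ X}

lemma measurePreserving_orbit (hτ : MeasurePreserving τ m m) (k : ℤ) :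
    MeasurePreserving (orbit τ k) m m := by
  obtain ⟨n, rfl | rfl⟩ := k.eq_nat_or_neg
  · rw [orbit_natCast]
    exact hτ.iterate n
  · rw [orbit_neg_natCast]
    exact (hτ.symm τ).iterate n

lemma averageTerm_eq (μ : Measure ℤ) (τ : X ≃ᵐ X) (f : X → ℝ) (x : X) (k : ℤ) :
    averageTerm μ τ f x k = μ.real {k} * f (orbit τ k x) := rfl

lemma tsum_measure_singleton (μ : Measure ℤ) [IsProbabilityMeasure μ] : ∑' k, μ {k} = 1 := by
  simpa using (lintegral_countable' (μ := μ) (fun _ => 1)).symm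

lemma summable_real_singleton (μ : Measure ℤ) [IsProbabilityMeasure μ] :
    Summable fun k => μ.real {k} :=
  ENNReal.summable_toReal (by rw [tsum_measure_singleton]; exact ENNReal.one_ne_top)

lemma tsum_real_singleton (μ : Measure ℤ) [IsProbabilityMeasure μ] : ∑' k, μ.real {k} = 1 := by
  simp only [Measure.real]
  rw [← ENNReal.tsum_toReal_eq fun k => measure_ne_top μ _, tsum_measure_singleton]
  rfl

lemma ae_summable_averageTerm (hτ : MeasurePreserving τ m m) (μ : Measure ℤ)
    [IsProbabilityMeasure μ] {f : X → ℝ} (hf : Integrable f m) :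
    ∀ᵐ x ∂m, Summable (averageTerm μ τ f x) := by
  have hmeas : ∀ k, AEMeasurable (fun x => μ {k} * ‖f (orbit τ k x)‖ₑ) m := fun k =>
    AEMeasurable.const_mul ((measurePreserving_orbit hτ k).integrable_comp_of_integrable
      hf).aestronglyMeasurable.enorm _
  have h1 : ∫⁻ x, ∑' k, μ {k} * ‖f (orbit τ k x)‖ₑ ∂m ≠ ∞ := by
    rw [lintegral_tsum hmeas]
    have h2 : ∀ k, ∫⁻ x, μ {k} * ‖f (orbit τ k x)‖ₑ ∂m = μ {k} * ∫⁻ x, ‖f x‖ₑ ∂m := by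
      intro k
      have hk := measurePreserving_orbit hτ k
      rw [lintegral_const_mul' _ _ (measure_ne_top _ _)]
      congr 1
      have := lintegral_map' (μ := m) (f := fun x => ‖f x‖ₑ) (g := orbit τ k)
        (by rw [hk.map_eq]; exact hf.aestronglyMeasurable.enorm) hk.aemeasurable
      rw [← this, hk.map_eq]
    simp only [h2]
    rw [ENNReal.tsum_mul_right, tsum_measure_singleton, one_mul]
    exact hf.2.ne
  filter_upwards [ae_lt_top' (AEMeasurable.tsum hmeas) h1] with x hx
  refine Summable.of_norm ?_
  refine (ENNReal.summable_toReal hx.ne).congr fun k => ?_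
  simp [averageTerm_eq, Measure.real]

lemma average_add_add {μ : Measure ℤ} {f h c e : X → ℝ} {x : X} (hfe : ∀ y, f y = h y + c y + e y)
    (sh : Summable (averageTerm μ τ h x)) (sc : Summable (averageTerm μ τ c x))
    (se : Summable (averageTerm μ τ e x)) :
    average μ τ f x = average μ τ h x + average μ τ c x + average μ τ e x := by
  unfold average
  rw [← sh.tsum_add sc, ← (sh.add sc).tsum_add se]
  congr 1
  ext k
  simp only [averageTerm_eq, hfe]
  ring

/-- Weighted averages reproduce invariant functions. -/
lemma ae_average_eq_of_invariant (hτ : MeasurePreserving τ m m) {h : X → ℝ}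
    (hinv : ∀ᵐ x ∂m, h (τ x) = h x) :
    ∀ᵐ x ∂m, ∀ (μ : Measure ℤ) [IsProbabilityMeasure μ], average μ τ h x = h x := by
  have h1 : ∀ᵐ x ∂m, ∀ k : ℤ, h (τ (orbit τ k x)) = h (orbit τ k x) :=
    ae_all_iff.2 fun k => (measurePreserving_orbit hτ k).quasiMeasurePreserving.ae hinv
  filter_upwards [h1] with x hx μ hμ
  have hx0 : ∀ k : ℤ, h (orbit τ k x) = h x := by
    intro k
    induction k using Int.induction_on with
    | zero => rfl
    | succ k ih => rw [orbit_add_one, hx, ih]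
    | pred k ih => rw [← ih, ← hx (-(k : ℤ) - 1), ← orbit_add_one, sub_add_cancel]
  unfold average
  simp only [averageTerm_eq, hx0]
  rw [tsum_mul_right, tsum_real_singleton, one_mul]

lemma abs_average_coboundary_le (μ : Measure ℤ) [IsProbabilityMeasure μ] {g : X → ℝ} {B : ℝ}
    (hB : ∀ x, |g x| ≤ B) (x : X) :
    |average μ τ (fun y => g y - g (τ y)) x| ≤
      B * ∑' k : ℤ, |μ.real {k + 1} - μ.real {k}| := by
  have hs := summable_real_singleton μ
  have hs1 : Summable fun k : ℤ => μ.real {k + 1} :=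
    hs.comp_injective (add_left_injective (1 : ℤ))
  have bdd : ∀ (w : ℤ → ℝ) (y : ℤ → X), Summable w → Summable fun k => w k * g (y k) :=
    fun w y hw => Summable.of_norm_bounded (hw.abs.mul_right B) fun k => by
      rw [norm_mul]
      exact mul_le_mul_of_nonneg_left (hB _) (abs_nonneg _)
  have hd : Summable fun k : ℤ => |μ.real {k + 1} - μ.real {k}| := (hs1.sub hs).abs
  have key : average μ τ (fun y => g y - g (τ y)) x =
      ∑' k : ℤ, (μ.real {k + 1} - μ.real {k}) * g (orbit τ (k + 1) x) := by
    unfold average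
    simp only [averageTerm_eq, ← orbit_add_one, mul_sub, sub_mul]
    rw [(bdd _ _ hs).tsum_sub (bdd _ _ hs), (bdd _ _ hs1).tsum_sub (bdd _ _ hs)]
    congr 1
    exact ((Equiv.addRight (1 : ℤ)).tsum_eq fun k => μ.real {k} * g (orbit τ k x)).symm
  rw [key, ← Real.norm_eq_abs, ← tsum_mul_left]
  refine tsum_of_norm_bounded (hd.mul_left B).hasSum fun k => ?_
  rw [norm_mul, mul_comm]
  exact mul_le_mul_of_nonneg_right (hB _) (abs_nonneg _)

/-- The weak type `(1, 1)` maximal inequality for kernels satisfying the bounds of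
`exists_kernel_bounds`: off a set of measure `O(‖f‖₁ / α)` all the averages of `f` are `O(α)`. -/
theorem exists_exceptional_set [IsFiniteMeasure m] (hτ : MeasurePreserving τ m m) {f : X → ℝ}
    (hf : Integrable f m) {α : ℝ} (hα : 0 < α) :
    ∃ S : Set X, m S ≤ ENNReal.ofReal (2 * ((∫ x, |f x| ∂m) / α)) ∧
      ∀ x ∉ S, ∀ (μ : Measure ℤ) (A s : ℝ), 0 ≤ A → 1 ≤ s →
        (∀ k : ℤ, μ.real {k} ≤ A / s ∧ (k : ℝ) ^ 2 * μ.real {k} ≤ A * s) →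
        Summable (averageTerm μ τ f x) → |average μ τ f x| ≤ 16 * A * α := by
  set F : X → ℝ := fun x => |f x|
  refine ⟨{x | ∃ n : ℕ, α * n < birkhoffSum τ F n x} ∪
    {x | ∃ n : ℕ, α * n < birkhoffSum τ.symm F n x}, ?_, ?_⟩
  · -- one exceptional set for each of the two directions of time
    refine (measure_union_le _ _).trans ?_
    have h0 : 0 ≤ (∫ x, F x ∂m) / α :=
      div_nonneg (integral_nonneg fun x => abs_nonneg _) hα.le
    rw [two_mul, ENNReal.ofReal_add h0 h0]
    exact add_le_add
      (measure_exists_lt_birkhoffSum_le hτ hf.abs (fun x => abs_nonneg _) hα)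
      (measure_exists_lt_birkhoffSum_le (hτ.symm τ) hf.abs (fun x => abs_nonneg _) hα)
  · intro x hx μ A s hA hs hb hsum
    simp only [Set.mem_union, Set.mem_ofPred_eq, not_or, not_exists, not_lt] at hx
    have hmain := tsum_le_of_decay (s := s) (A := 4 * A) (α := α) hs (by positivity) hα.le
      (w := fun k => μ.real {k}) (a := fun k => F (orbit τ k x)) (fun k => measureReal_nonneg)
      (fun k => le_decayWeight_of_bounds (by linarith) measureReal_nonneg k (hb k).1 (hb k).2)
      (fun k => abs_nonneg _)
      (fun n => by simpa only [birkhoffSum, orbit_natCast] using hx.1 n)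
      (fun n => by simpa only [birkhoffSum, orbit_neg_natCast] using hx.2 n)
    have habs : ∀ k, ‖averageTerm μ τ f x k‖ = μ.real {k} * F (orbit τ k x) := fun k => by
      rw [averageTerm_eq, norm_mul, Real.norm_eq_abs, Real.norm_eq_abs,
        abs_of_nonneg measureReal_nonneg]
    calc |average μ τ f x| ≤ ∑' k, ‖averageTerm μ τ f x k‖ := norm_tsum_le_tsum_norm hsum.norm
      _ ≤ _ := by
          simp only [habs]
          linarith

/-! ### Invariant functions and coboundaries are dense -/

lemma coeFn_birkhoffSum_compMeasurePreserving (hτ : MeasurePreserving τ m m) {s : X → ℝ}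
    (hs : MemLp s 2 m) (N : ℕ) :
    (birkhoffSum (Lp.compMeasurePreservingₗᵢ ℝ τ hτ) _root_.id N (hs.toLp s) : Lp ℝ 2 m) =ᵐ[m]
      birkhoffSum τ s N := by
  have hit : ∀ k : ℕ, (Lp.compMeasurePreservingₗᵢ ℝ τ hτ)^[k] (hs.toLp s) =
      (hs.comp_measurePreserving (hτ.iterate k)).toLp _ := by
    intro k
    induction k with
    | zero => rfl
    | succ k ih =>
      rw [Function.iterate_succ_apply', ih]
      refine (Lp.toLp_compMeasurePreserving _ hτ).trans ?_
      congr 1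
  induction N with
  | zero => simpa [birkhoffSum_zero'] using Lp.coeFn_zero ℝ 2 m
  | succ N ih =>
    rw [birkhoffSum_succ]
    refine (Lp.coeFn_add _ _).trans ?_
    have h2 : (_root_.id ((Lp.compMeasurePreservingₗᵢ ℝ τ hτ)^[N] (hs.toLp s)) : Lp ℝ 2 m) =ᵐ[m]
        s ∘ τ^[N] := by
      rw [_root_.id, hit]
      exact MemLp.coeFn_toLp _
    filter_upwards [ih, h2] with x h3 h4
    rw [Pi.add_apply, h3, h4, birkhoffSum_succ]
    rfl

/-- Every integrable function is, up to a small error in `L¹`, the sum of an invariant function and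
a bounded coboundary. A simple function `s` close to `f` differs from its ergodic average of length
`N` by an explicit coboundary, and these averages converge by the mean ergodic theorem. -/
theorem exists_invariant_add_coboundary [IsProbabilityMeasure m] (hτ : MeasurePreserving τ m m)
    {f : X → ℝ} (hf : Integrable f m) {ε : ℝ} (hε : 0 < ε) :
    ∃ h g e : X → ℝ, (∀ x, f x = h x + (g x - g (τ x)) + e x) ∧ Integrable h m ∧
      (∀ᵐ x ∂m, h (τ x) = h x) ∧ Integrable g m ∧ (∃ B, ∀ x, |g x| ≤ B) ∧ Integrable e m ∧
      ∫ x, |e x| ∂m ≤ ε := by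
  obtain ⟨s, hs1, -⟩ := (memLp_one_iff_integrable.2 hf).exists_simpleFunc_eLpNorm_sub_lt
    ENNReal.one_ne_top (ε := ENNReal.ofReal (ε / 2)) (by simpa using hε)
  obtain ⟨B₀, hB₀⟩ : ∃ B, ∀ x, ‖s x‖ ≤ B := s.exists_forall_norm_le
  have hs2 : MemLp s 2 m := MemLp.of_bound s.aestronglyMeasurable B₀ (ae_of_all _ hB₀)
  have hsi : Integrable s m := hs2.integrable one_le_two
  set U := (Lp.compMeasurePreservingₗᵢ (E := ℝ) (p := 2) ℝ τ hτ).toContinuousLinearMap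
  have hU : ‖U‖ ≤ 1 := LinearIsometry.norm_toContinuousLinearMap_le _
  have hmet := U.tendsto_birkhoffAverage_orthogonalProjection hU (hs2.toLp s)
  set P := (U.toLinearMap.eqLocus
    (1 : Lp ℝ 2 m →L[ℝ] Lp ℝ 2 m).toLinearMap).orthogonalProjectionOnto (hs2.toLp s)
  obtain ⟨N, hN, hN1⟩ := ((Metric.tendsto_nhds.1 hmet (ε / 2) (by positivity)).and
    (eventually_ge_atTop 1)).exists
  have hPinv : U (P : Lp ℝ 2 m) = P := P.2
  set h : X → ℝ := ((P : Lp ℝ 2 m) : X → ℝ)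
  have hh2 : MemLp h 2 m := Lp.memLp _
  set a : X → ℝ := birkhoffAverage ℝ τ s N
  set g : X → ℝ := fun x => (N : ℝ)⁻¹ * ∑ k ∈ Finset.range N, birkhoffSum τ s k x
  have hbs : ∀ k, Integrable (birkhoffSum τ s k) m := fun k =>
    integrable_finsetSum _ fun i _ => (hτ.iterate i).integrable_comp_of_integrable hsi
  have hg : Integrable g m := (integrable_finsetSum _ fun k _ => hbs k).const_mul _
  have hN0 : (N : ℝ) ≠ 0 := by positivity
  have hga : ∀ x, g x - g (τ x) = s x - a x := by
    intro x
    simp only [g, a, birkhoffAverage, smul_eq_mul]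
    rw [← mul_sub, ← Finset.sum_sub_distrib]
    have : ∀ k, birkhoffSum τ s k x - birkhoffSum τ s k (τ x) = s x - s (τ^[k] x) := fun k => by
      rw [← neg_sub, birkhoffSum_apply_sub_birkhoffSum, neg_sub]
    rw [Finset.sum_congr rfl fun k _ => this k, Finset.sum_sub_distrib, Finset.sum_const,
      Finset.card_range, nsmul_eq_mul, mul_sub, inv_mul_cancel_left₀ hN0]
    rfl
  have ha : Integrable a m := (hbs N).const_mul _
  have hhi : Integrable h m := hh2.integrable one_le_two
  refine ⟨h, g, fun x => (f x - s x) + (a x - h x), fun x => ?_, hhi, ?_, hg, ?_,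
    (hf.sub hsi).add (ha.sub hhi), ?_⟩
  · rw [hga]
    ring
  · have h1 : (U (P : Lp ℝ 2 m) : X → ℝ) =ᵐ[m] h ∘ τ := Lp.coeFn_compMeasurePreserving _ hτ
    rw [hPinv] at h1
    filter_upwards [h1] with x hx using hx.symm
  · refine ⟨(N : ℝ)⁻¹ * ∑ k ∈ Finset.range N, (k : ℝ) * B₀, fun x => ?_⟩
    rw [abs_mul, abs_of_nonneg (by positivity)]
    gcongr
    refine (Finset.abs_sum_le_sum_abs _ _).trans (Finset.sum_le_sum fun k _ => ?_)
    refine (Finset.abs_sum_le_sum_abs _ _).trans ?_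
    refine (Finset.sum_le_sum fun i _ => hB₀ (τ^[i] x)).trans ?_
    simp
  · have i1 : ∫ x, |f x - s x| ∂m ≤ ε / 2 := by
      have h1 := eLpNorm_one_eq_lintegral_enorm (μ := m) (f := f - (s : X → ℝ))
      have h2 := ofReal_integral_norm_eq_lintegral_enorm (hf.sub hsi)
      rw [← h1] at h2
      rw [← h2] at hs1
      exact ((ENNReal.ofReal_lt_ofReal_iff (by positivity)).1 hs1).le
    have i2 : ∫ x, |a x - h x| ∂m ≤ ε / 2 := by
      have h1 := eLpNorm_one_eq_lintegral_enorm (μ := m) (f := a - h)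
      have h2 := ofReal_integral_norm_eq_lintegral_enorm (ha.sub hhi)
      rw [← h1] at h2
      have h3 : eLpNorm (a - h) 1 m ≤ eLpNorm (a - h) 2 m :=
        eLpNorm_le_eLpNorm_of_exponent_le one_le_two (ha.sub hhi).aestronglyMeasurable
      have h4 : ((birkhoffAverage ℝ U _root_.id N (hs2.toLp s) : Lp ℝ 2 m) : X → ℝ) =ᵐ[m] a := by
        refine (Lp.coeFn_smul _ _).trans ?_
        filter_upwards [coeFn_birkhoffSum_compMeasurePreserving hτ hs2 N] with x hx
        exact congrArg (fun z => (N : ℝ)⁻¹ • z) hx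
      have h5 : eLpNorm (a - h) 2 m =
          ENNReal.ofReal (dist (birkhoffAverage ℝ U _root_.id N (hs2.toLp s)) (P : Lp ℝ 2 m)) := by
        rw [← edist_dist, Lp.edist_def]
        exact eLpNorm_congr_ae (h4.symm.sub EventuallyEq.rfl)
      rw [h5, ← h2] at h3
      exact ((ENNReal.ofReal_le_ofReal_iff dist_nonneg).1 h3).trans hN.le
    calc ∫ x, |(f x - s x) + (a x - h x)| ∂m ≤ ∫ x, (|f x - s x| + |a x - h x|) ∂m :=
          integral_mono ((hf.sub hsi).add (ha.sub hhi)).abs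
            ((hf.sub hsi).abs.add (ha.sub hhi).abs) fun x => abs_add_le _ _
      _ = ∫ x, |f x - s x| ∂m + ∫ x, |a x - h x| ∂m :=
          integral_add (hf.sub hsi).abs (ha.sub hhi).abs
      _ ≤ ε := by linarith

/-- Almost everywhere convergence for kernels satisfying the bounds of `exists_kernel_bounds`. The
errors of the approximations by invariant functions and coboundaries are chosen summable, so that
the maximal inequality and the Borel–Cantelli lemma make the averages Cauchy. -/
theorem ae_exists_tendsto_average [IsProbabilityMeasure m] (hτ : MeasurePreserving τ m m)
    {μ : ℕ → Measure ℤ} (hμ : ∀ n, IsProbabilityMeasure (μ n)) {A : ℝ} (hA : 0 ≤ A) {n₁ : ℕ}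
    (hn₁ : 1 ≤ n₁)
    (hb : ∀ n ≥ n₁, ∀ k : ℤ, (μ n).real {k} ≤ A / √n ∧ (k : ℝ) ^ 2 * (μ n).real {k} ≤ A * √n ∧
      |(μ n).real {k + 1} - (μ n).real {k}| ≤ A / n) {f : X → ℝ} (hf : Integrable f m) :
    ∀ᵐ x ∂m, ∃ l : ℝ, Tendsto (fun n => average (μ n) τ f x) atTop (𝓝 l) := by
  -- errors of norm `4⁻ʲ` exceed the level `2⁻ʲ` on sets of measure `O(2⁻ʲ)`
  have hpos : ∀ j : ℕ, (0 : ℝ) < (1 / 4) ^ j := fun j => by positivity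
  choose h g e hfe hhi hinv hgi hB hei he using fun j =>
    exists_invariant_add_coboundary hτ hf (hpos j)
  choose B hB using hB
  choose S hS hmax using fun j => exists_exceptional_set hτ (hei j)
    (α := (1 / 2) ^ j) (by positivity)
  have hSsum : ∑' j, m (S j) ≠ ∞ := by
    have h1 : ∀ j, m (S j) ≤ ENNReal.ofReal (2 * (1 / 2) ^ j) := fun j => by
      refine (hS j).trans (ENNReal.ofReal_le_ofReal ?_)
      gcongr
      rw [div_le_iff₀ (by positivity), ← mul_pow]
      norm_num
      simpa using he j
    refine ne_top_of_le_ne_top ?_ (ENNReal.tsum_le_tsum h1)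
    rw [← ENNReal.ofReal_tsum_of_nonneg (fun j => by positivity)
      (summable_geometric_two.mul_left 2)]
    exact ENNReal.ofReal_ne_top
  have hTV := tendsto_tsum_abs_sub_of_bounds (p := fun n k => (μ n).real {k})
    (fun n k => measureReal_nonneg) hA hn₁ hb
  have hci : ∀ j, Integrable (fun x => g j x - g j (τ x)) m := fun j =>
    (hgi j).sub (hτ.integrable_comp_of_integrable (hgi j))
  have sh : ∀ᵐ x ∂m, ∀ j n, Summable (averageTerm (μ n) τ (h j) x) :=
    ae_all_iff.2 fun j => ae_all_iff.2 fun n => ae_summable_averageTerm hτ (μ n) (hhi j)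
  have sc : ∀ᵐ x ∂m, ∀ j n, Summable (averageTerm (μ n) τ (fun x => g j x - g j (τ x)) x) :=
    ae_all_iff.2 fun j => ae_all_iff.2 fun n => ae_summable_averageTerm hτ (μ n) (hci j)
  have se : ∀ᵐ x ∂m, ∀ j n, Summable (averageTerm (μ n) τ (e j) x) :=
    ae_all_iff.2 fun j => ae_all_iff.2 fun n => ae_summable_averageTerm hτ (μ n) (hei j)
  have hI := ae_all_iff.2 fun j => ae_average_eq_of_invariant hτ (hinv j)
  filter_upwards [ae_eventually_notMem hSsum, sh, sc, se, hI] with x hxS hsh hsc hse hxI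
  refine cauchySeq_tendsto_of_complete (Metric.cauchySeq_iff'.2 fun δ hδ => ?_)
  have hlim : Tendsto (fun j : ℕ => 16 * A * (1 / 2 : ℝ) ^ j) atTop (𝓝 0) := by
    simpa using (tendsto_pow_atTop_nhds_zero_of_lt_one (r := (1 / 2 : ℝ)) (by norm_num)
      (by norm_num)).const_mul (16 * A)
  obtain ⟨j, hj, hjδ⟩ := (hxS.and (hlim.eventually_lt_const (by positivity : 0 < δ / 4))).exists
  have hlim2 : Tendsto (fun n => B j * ∑' k : ℤ, |(μ n).real {k + 1} - (μ n).real {k}|) atTop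
      (𝓝 0) := by
    simpa using hTV.const_mul (B j)
  obtain ⟨n₂, hn₂⟩ := eventually_atTop.1
    (hlim2.eventually_lt_const (by positivity : 0 < δ / 4))
  have hclose : ∀ n ≥ max n₁ n₂, |average (μ n) τ f x - h j x| < δ / 2 := by
    intro n hn
    have hn1 : n₁ ≤ n := (le_max_left _ _).trans hn
    have hn2 := hn₂ n ((le_max_right _ _).trans hn)
    have hs : 1 ≤ √(n : ℝ) := Real.one_le_sqrt.2 (by exact_mod_cast hn₁.trans hn1)
    have h1 := hmax j x hj (μ n) A (√n) hA hs
      (fun k => ⟨(hb n hn1 k).1, (hb n hn1 k).2.1⟩) (hse j n)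
    have h2 := abs_average_coboundary_le (τ := τ) (μ n) (hB j) x
    rw [average_add_add (hfe j) (hsh j n) (hsc j n) (hse j n), hxI j (μ n)]
    rw [abs_lt]
    rw [abs_le] at h1 h2
    constructor <;> linarith [h1.1, h1.2, h2.1, h2.2]
  refine ⟨max n₁ n₂, fun n hn => ?_⟩
  have h1 := abs_lt.1 (hclose n hn)
  have h2 := abs_lt.1 (hclose _ le_rfl)
  rw [Real.dist_eq, abs_lt]
  constructor <;> linarith [h1.1, h1.2, h2.1, h2.2]

end dynamics

end ConvMeasures

end

/-- The sequence `ν` is indexed from `0`: `ν i` is the `(i+1)`-st measure of the sequence, so that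
`convProd ν n` is the convolution of the first `n` measures. -/
theorem theorem2p2p2 {X : Type*} [MeasurableSpace X] (m : Measure X) [IsProbabilityMeasure m]
    (τ : X ≃ᵐ X) (hτ : MeasurePreserving τ m m)
    (ν : ℕ → Measure ℤ) (hprob : ∀ n, IsProbabilityMeasure (ν n))
    (haper : ∀ n, ConvMeasures.StrictlyAperiodic (ν n))
    (hmean : ∀ n, ConvMeasures.expectation (ν n) = 0)
    (hmoment : ∃ K : ℝ≥0, ∀ᶠ n : ℕ in atTop,
      ∑ i ∈ Finset.range n, ConvMeasures.moment 2 (ν i) ≤ (K : ℝ≥0∞) * (n : ℝ≥0∞))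
    (hfourier : ∃ C : ℝ, 0 < C ∧ ∃ N₀ : ℕ, ∀ n > N₀, ∀ t ∈ Set.Ico (-(1 / 2) : ℝ) (1 / 2),
      ‖ConvMeasures.fourierTransform (ν n) t‖ ≤ Real.exp (-C * t ^ 2))
    (f : X → ℝ) (hf : Integrable f m) :
    ∀ᵐ x ∂m,
      (∀ n, Summable (ConvMeasures.averageTerm (ConvMeasures.convProd ν n) τ f x)) ∧
      ∃ l : ℝ, Tendsto (fun n => ConvMeasures.average (ConvMeasures.convProd ν n) τ f x)
        atTop (𝓝 l) := by
  obtain ⟨K, hK⟩ := hmoment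
  obtain ⟨n₁, hn₁⟩ := eventually_atTop.1 hK
  obtain ⟨C, hC, N₀, hF⟩ := hfourier
  -- every second moment is finite, being a term of a finite sum
  have hfin : ∀ i, ConvMeasures.moment 2 (ν i) ≠ ∞ := by
    intro i
    refine ne_top_of_le_ne_top (ENNReal.mul_ne_top ENNReal.coe_ne_top (ENNReal.natCast_ne_top _))
      (le_trans ?_ (hn₁ (max n₁ (i + 1)) (le_max_left _ _)))
    exact Finset.single_le_sum (f := fun i => ConvMeasures.moment 2 (ν i)) (fun _ _ => zero_le)
      (Finset.mem_range.2 (lt_of_lt_of_le (Nat.lt_succ_self i) (le_max_right _ _)))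
  have hM : ∀ n ≥ max n₁ 1, ∑ i ∈ Finset.range n, ConvMeasures.variance (ν i) ≤ (K : ℝ) * n := by
    intro n hn
    have h1 := hn₁ n ((le_max_left _ _).trans hn)
    simp only [ConvMeasures.moment_two_eq_ofReal (hfin _)] at h1
    rw [← ENNReal.ofReal_sum_of_nonneg fun i _ => ConvMeasures.variance_nonneg _] at h1
    have h2 : (K : ℝ≥0∞) * n = ENNReal.ofReal (K * n) := by
      rw [ENNReal.ofReal_mul K.coe_nonneg, ENNReal.ofReal_coe_nnreal, ENNReal.ofReal_natCast]
    rw [h2] at h1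
    exact (ENNReal.ofReal_le_ofReal_iff (by positivity)).1 h1
  have hμ := ConvMeasures.isProbabilityMeasure_convProd hprob
  obtain ⟨A, hA, hb⟩ := ConvMeasures.exists_kernel_bounds hprob
    (fun n => ConvMeasures.integrable_sq_of_moment (hfin n)) hmean hC hF K.coe_nonneg
    (le_max_right n₁ 1) hM
  filter_upwards [ae_all_iff.2 fun n =>
      ConvMeasures.ae_summable_averageTerm hτ (ConvMeasures.convProd ν n) hf,
    ConvMeasures.ae_exists_tendsto_average hτ hμ hA.le (le_max_right n₁ 1) hb hf] with x h1 h2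
  exact ⟨h1, h2⟩
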